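/- Let $V:\mathbb{R}\to\mathbb{R}$ be a nondecreasing function with $\lim_{x\to-\infty}V(x)=v_0>0$ and $\lim_{x\to+\infty}V(x)=v_1<\infty$. Let $H^1(\mathbb{R})$ be the space of real-valued $u\in L^2(\mathbb{R})$ with weak derivative $u'\in L^2(\mathbb{R})$, each $u$ being identified with its continuous representative. For $u\in H^1(\mathbb{R})$ set $$\|u\|_V^2=\int_{\mathbb{R}}\bigl(|u'(x)|^2+V(x)|u(x)|^2\bigr)\,dx,$$ and define $$m(V)=\inf_{u\in H^1(\mathbb{R}),\,u\not\equiv0}\frac{\|u\|_V^2}{\|u\|_{L^\infty(\mathbb{R})}^2},\qquad M(V)=\Bigl\{u\in H^1(\mathbb{R}) : u\not\equiv0,\ \frac{\|u\|_V^2}{\|u\|_{L^\infty(\mathbb{R})}^2}=m(V)\Bigr\},$$ and, for $a\in\mathbb{R}$, $$F(a)=\inf\bigl\{\|u\|_V^2 : u\in H^1(\mathbb{R}),\ u(a)=\|u\|_{L^\infty(\mathbb{R})}=1\bigr\}.$$ Then $$m(V)=\lim_{a\to-\infty}F(a)=2\sqrt{v_0}.$$ Furthermore, if $v_0<v_1$,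 then $F$ is strictly increasing on $\mathbb{R}$ and $M(V)=\emptyset$. -/

import Mathlib

noncomputable section

open MeasureTheory

namespace SobolevConst

/-- `g` is a weak derivative of `u` on the real line: both are locally integrable and
`∫ u φ' = -∫ g φ` for every test function `φ ∈ C_c^∞(ℝ)`. -/
def HasWeakDeriv (u g : ℝ → ℝ) : Prop :=
  LocallyIntegrable u ∧ LocallyIntegrable g ∧
    ∀ φ : ℝ → ℝ, ContDiff ℝ (⊤ : ℕ∞) φ → HasCompactSupport φ →
      ∫ x, u x * deriv φ x = -∫ x, g x * φ x

/-- Weak derivatives are unique almost everywhere. -/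
theorem HasWeakDeriv.ae_unique {u g h : ℝ → ℝ} (hg : HasWeakDeriv u g)
    (hh : HasWeakDeriv u h) : g =ᵐ[volume] h := by
  refine ae_eq_of_integral_contDiff_smul_eq hg.2.1 hh.2.1 fun φ hφ hc => ?_
  have h1 := hg.2.2 φ hφ hc
  have h2 := hh.2.2 φ hφ hc
  simp only [smul_eq_mul, mul_comm (φ _)]
  linarith

/-- The weak derivative `u'` of `u` (a representative of it; `0` if there is none). -/
def weakDeriv (u : ℝ → ℝ) : ℝ → ℝ :=
  open Classical in if h : ∃ g, HasWeakDeriv u g then h.choose else 0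

/-- Up to null sets, `weakDeriv u` is any given weak derivative of `u`. -/
theorem HasWeakDeriv.weakDeriv_ae_eq {u g : ℝ → ℝ} (hg : HasWeakDeriv u g) :
    weakDeriv u =ᵐ[volume] g := by
  have h : ∃ g, HasWeakDeriv u g := ⟨g, hg⟩
  rw [weakDeriv, dif_pos h]
  exact h.choose_spec.ae_unique hg

/-- `u ∈ H¹(ℝ) = W^{1,2}(ℝ)` (real-valued), where `u` is the continuous representative of its
class: `u ∈ L²` has a weak derivative in `L²`. -/
def MemH1 (u : ℝ → ℝ) : Prop :=
  Continuous u ∧ MemLp u 2 volume ∧ ∃ g, HasWeakDeriv u g ∧ MemLp g 2 volume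

/-- The norm `‖u‖_∞` of `L^∞(ℝ)`. -/
def supNorm (u : ℝ → ℝ) : ℝ := (eLpNorm u ⊤ volume).toReal

/-- The energy `I(u; V) = ‖u‖_V² = ∫ (|u'|² + V |u|²)`. -/
def energy (V u : ℝ → ℝ) : ℝ := ∫ x, (|weakDeriv u x| ^ 2 + V x * |u x| ^ 2)

/-- The Rayleigh-type quotient `R(u; V) = ‖u‖_V² / ‖u‖_∞²`. -/
def rayleigh (V u : ℝ → ℝ) : ℝ := energy V u / supNorm u ^ 2

/-- `m(V)`, the infimum of `R(u; V)` over `u ∈ H¹(ℝ)`, `u ≢ 0`. -/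
def infRayleigh (V : ℝ → ℝ) : ℝ := sInf (rayleigh V '' {u | MemH1 u ∧ u ≠ 0})

/-- `M(V)`, the set of minimizers of `R(·; V)` over `u ∈ H¹(ℝ)`, `u ≢ 0`. -/
def minimizers (V : ℝ → ℝ) : Set (ℝ → ℝ) :=
  {u | MemH1 u ∧ infRayleigh V = rayleigh V u ∧ u ≠ 0}

/-- `K_a = {u ∈ H¹(ℝ) : u(a) = ‖u‖_∞ = 1}`. -/
def peakSet (a : ℝ) : Set (ℝ → ℝ) := {u | MemH1 u ∧ u a = 1 ∧ supNorm u = 1}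

/-- `F(a)`, the infimum of `‖u‖_V²` over `u ∈ K_a`. -/
def peakEnergy (V : ℝ → ℝ) (a : ℝ) : ℝ := sInf (energy V '' peakSet a)

end SobolevConst

end

/-! For the constant potential k², the kernel `expKernel k a` represents evaluation at a: its energy
pairing with any w in H¹ equals 2k w(a) (`integral_expKernel`). Expanding ‖u - u(a)φ‖² ≥ 0 for this
kernel φ gives 2k u(a)² ≤ ‖u‖² (`MemH1.mul_sq_le`). Since V ≥ v₀, every quotient and every F(a) is
at least 2√v₀. The kernels with k = √v₀ make this sharp as a → -∞, because the potential around
their peak tends to v₀ (`tendsto_energy_expKernel`).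

For strict monotonicity let a < b, d = b - a, and let u be admissible at b. Shifting u by d gives a
competitor at a whose energy sees V(x - d) ≤ V(x). The infimum is not known to be attained, so the
gain must be bounded below uniformly in u. Therefore u is first replaced by max(u, φ) with φ =
`expKernel √v₁ b`. As V ≤ v₁, φ is a subsolution away from b, and the energy does not increase
(`energy_max_expKernel_le`). The gain is then at least ∫ (V(x) - V(x - d)) φ², which is positive and
independent of u (`integral_sub_comp_sub_pos`).

A minimizer normalized at its peak a would force F(a) ≤ 2√v₀ ≤ F(a - 1) < F(a). All of this rests on
`memH1_iff`, which trades weak derivatives for a.e. derivatives of absolutely continuous functions.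
-/

noncomputable section

open MeasureTheory

namespace SobolevConst

open Set Filter Topology

/-! ### Locally absolutely continuous functions -/

/-- Absolute continuity on every compact interval. -/
def LocallyAC (u : ℝ → ℝ) : Prop := ∀ a b, AbsolutelyContinuousOnInterval u a b

theorem LocallyAC.continuous {u : ℝ → ℝ} (hu : LocallyAC u) : Continuous u := by
  rw [continuous_iff_continuousAt]
  intro x
  refine (hu (x - 1) (x + 1)).continuousOn.continuousAt ?_
  rw [uIcc_of_le (by linarith)]
  exact Icc_mem_nhds (by linarith) (by linarith)

theorem LocallyAC.ae_differentiableAt {u : ℝ → ℝ} (hu : LocallyAC u) :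
    ∀ᵐ x, DifferentiableAt ℝ u x := by
  have h : ∀ᵐ x : ℝ, ∀ n : ℕ, x ∈ uIcc (-n : ℝ) n → DifferentiableAt ℝ u x :=
    ae_all_iff.2 fun n => (hu _ _).ae_differentiableAt
  filter_upwards [h] with x hx
  obtain ⟨n, hn⟩ := exists_nat_ge |x|
  refine hx n ?_
  rw [uIcc_of_le (by linarith [abs_nonneg x])]
  exact abs_le.1 hn

theorem LocallyAC.integral_deriv {u : ℝ → ℝ} (hu : LocallyAC u) (a b : ℝ) :
    ∫ x in a..b, deriv u x = u b - u a :=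
  (hu a b).integral_deriv_eq_sub

theorem LocallyAC.locallyIntegrable_deriv {u : ℝ → ℝ} (hu : LocallyAC u) :
    LocallyIntegrable (deriv u) := by
  intro x
  refine ⟨Icc (x - 1) (x + 1), Icc_mem_nhds (by linarith) (by linarith), ?_⟩
  have := (hu (x - 1) (x + 1)).intervalIntegrable_deriv
  rwa [intervalIntegrable_iff_integrableOn_Icc_of_le (by linarith)] at this

theorem LocallyIntegrable.intervalIntegrable {g : ℝ → ℝ} (hg : LocallyIntegrable g) (a b : ℝ) :
    IntervalIntegrable g volume a b :=
  (hg.integrableOn_isCompact isCompact_uIcc).intervalIntegrable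

theorem LocallyAC.of_integral {u g : ℝ → ℝ} (hg : LocallyIntegrable g)
    (h : ∀ x, u x = u 0 + ∫ t in (0 : ℝ)..x, g t) : LocallyAC u := by
  intro a b
  have h3 : AbsolutelyContinuousOnInterval (fun _ : ℝ => u 0) a b :=
    (LipschitzWith.const (u 0)).lipschitzOnWith.absolutelyContinuousOnInterval
  have h2 : AbsolutelyContinuousOnInterval (fun x ↦ ∫ v in (0 : ℝ)..x, g v) a b := by
    -- The primitive is based at 0, which need not lie between a and b; hence the enlarged interval.
    have := (LocallyIntegrable.intervalIntegrable hg (min (min a b) 0) (max (max a b) 0)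
      ).absolutelyContinuousOnInterval_intervalIntegral (c := (0 : ℝ)) (by
        rw [uIcc_of_le (by simp)]; simp)
    refine this.mono ?_
    rw [uIcc_of_le (a := min (min a b) 0) (by simp)]
    exact Icc_subset_Icc (by simp) (by simp)
  have h4 := h3.add h2
  have : u = (fun _ : ℝ => u 0) + fun x ↦ ∫ v in (0 : ℝ)..x, g v := funext h
  rw [this]
  exact h4

theorem ae_deriv_eq_of_integral {u g : ℝ → ℝ} (hg : LocallyIntegrable g)
    (h : ∀ x, u x = u 0 + ∫ t in (0 : ℝ)..x, g t) : deriv u =ᵐ[volume] g := by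
  filter_upwards [LocallyIntegrable.ae_hasDerivAt_integral hg] with x hx
  have : u = fun x => u 0 + ∫ t in (0 : ℝ)..x, g t := funext h
  rw [this]
  exact ((hx 0).const_add _).deriv

theorem exists_tsupport_subset_Ioo {φ : ℝ → ℝ} (hc : HasCompactSupport φ) :
    ∃ S : ℝ, 0 < S ∧ tsupport φ ⊆ Ioo (-S) S := by
  obtain ⟨R, hR⟩ := hc.isCompact.isBounded.subset_closedBall 0
  refine ⟨|R| + 1, by positivity, fun x hx => ?_⟩
  have := hR hx
  rw [mem_closedBall_zero_iff, Real.norm_eq_abs] at this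
  have h2 := abs_le.1 (this.trans (le_abs_self R))
  constructor <;> linarith

/-- Integration by parts against a test function. -/
theorem LocallyAC.integral_mul_deriv {u φ : ℝ → ℝ} (hu : LocallyAC u)
    (hφ : ContDiff ℝ (⊤ : ℕ∞) φ) (hc : HasCompactSupport φ) :
    ∫ x, u x * deriv φ x = -∫ x, deriv u x * φ x := by
  obtain ⟨S, hS, hsub⟩ := exists_tsupport_subset_Ioo hc
  have hφac : AbsolutelyContinuousOnInterval φ (-S) S :=
    (hφ.of_le (by exact_mod_cast le_top)).contDiffOn.absolutelyContinuousOnInterval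
  have hzero : ∀ x, x ∉ Ioo (-S) S → φ x = 0 := fun x hx =>
    image_eq_zero_of_notMem_tsupport fun h => hx (hsub h)
  have hzero' : ∀ x, x ∉ Ioc (-S) S → deriv φ x = 0 := fun x hx => by
    by_contra h
    exact hx (Ioo_subset_Ioc_self (hsub (support_deriv_subset h)))
  have h1 := (hu (-S) S).integral_mul_deriv_eq_deriv_mul hφac
  rw [intervalIntegral.integral_of_le (by linarith), intervalIntegral.integral_of_le (by linarith),
    setIntegral_eq_integral_of_forall_compl_eq_zero (fun x hx => by rw [hzero' x hx, mul_zero]),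
    setIntegral_eq_integral_of_forall_compl_eq_zero
      (fun x hx => by rw [hzero x fun h => hx (Ioo_subset_Ioc_self h), mul_zero]),
    hzero _ (by simp), hzero _ (by simp)] at h1
  rw [h1]; ring

theorem LocallyAC.hasWeakDeriv {u : ℝ → ℝ} (hu : LocallyAC u) : HasWeakDeriv u (deriv u) :=
  ⟨hu.continuous.locallyIntegrable, hu.locallyIntegrable_deriv,
    fun _ hφ hc => hu.integral_mul_deriv hφ hc⟩

/-! ### From weak derivatives to primitives -/

/-- A test function of zero mean is the derivative of a test function. -/
theorem exists_primitive_of_integral_eq_zero {ψ : ℝ → ℝ} (hψ : ContDiff ℝ (⊤ : ℕ∞) ψ)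
    (hc : HasCompactSupport ψ) (h0 : ∫ x, ψ x = 0) :
    ∃ φ : ℝ → ℝ, ContDiff ℝ (⊤ : ℕ∞) φ ∧ HasCompactSupport φ ∧ deriv φ = ψ := by
  obtain ⟨S, hS, hsub⟩ := exists_tsupport_subset_Ioo hc
  have hzero : ∀ x, x ∉ Ioo (-S) S → ψ x = 0 := fun x hx =>
    image_eq_zero_of_notMem_tsupport fun h => hx (hsub h)
  have hd : ∀ x, HasDerivAt (fun x => ∫ t in (-S)..x, ψ t) (ψ x) x := fun x =>
    intervalIntegral.integral_hasDerivAt_right (hψ.continuous.intervalIntegrable _ _)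
      (hψ.continuous.stronglyMeasurableAtFilter _ _) hψ.continuous.continuousAt
  have hderiv : deriv (fun x => ∫ t in (-S)..x, ψ t) = ψ := funext fun x => (hd x).deriv
  refine ⟨fun x => ∫ t in (-S)..x, ψ t, ?_, ?_, hderiv⟩
  · rw [contDiff_infty_iff_deriv, hderiv]
    exact ⟨fun x => (hd x).differentiableAt, hψ⟩
  · refine HasCompactSupport.intro (isCompact_Icc (a := -S) (b := S)) fun x hx => ?_
    rcases lt_or_ge x (-S) with hneg | hpos
    · refine (intervalIntegral.integral_congr (g := fun _ => (0 : ℝ)) fun t ht => ?_).trans (by simp)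
      rw [uIcc_of_ge hneg.le] at ht
      exact hzero t fun h => absurd h.1 (not_lt.2 ht.2)
    · have hxS : S < x := by
        by_contra h
        exact hx ⟨hpos, not_lt.1 h⟩
      rw [intervalIntegral.integral_of_le hpos,
        setIntegral_eq_integral_of_forall_compl_eq_zero, h0]
      exact fun y hy => hzero y fun h => hy ⟨h.1, (h.2.trans hxS).le⟩

/-- The du Bois-Reymond lemma. -/
theorem eq_const_of_forall_integral_mul_deriv_eq_zero {h : ℝ → ℝ} (hh : Continuous h)
    (h0 : ∀ φ : ℝ → ℝ, ContDiff ℝ (⊤ : ℕ∞) φ → HasCompactSupport φ → ∫ x, h x * deriv φ x = 0) :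
    ∃ c, ∀ x, h x = c := by
  let b : ContDiffBump (0 : ℝ) := ⟨1, 2, one_pos, one_lt_two⟩
  set ρ : ℝ → ℝ := b.normed volume with hρ
  have hρs : ContDiff ℝ (⊤ : ℕ∞) ρ := b.contDiff_normed
  have hρc : HasCompactSupport ρ := b.hasCompactSupport_normed
  have hρ1 : ∫ x, ρ x = 1 := b.integral_normed
  have hint : ∀ {ψ : ℝ → ℝ}, Continuous ψ → HasCompactSupport ψ → Integrable ψ :=
    fun h1 h2 => h1.integrable_of_hasCompactSupport h2
  refine ⟨∫ x, h x * ρ x, fun x => ?_⟩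
  have key : h =ᵐ[volume] fun _ => ∫ x, h x * ρ x := by
    refine ae_eq_of_integral_contDiff_smul_eq hh.locallyIntegrable
      (locallyIntegrable_const _) fun ψ hψ hψc => ?_
    set I := ∫ x, ψ x with hI
    -- Subtracting I times the unit-mass bump ρ leaves mean zero, so the difference is φ' for a test
    -- function φ and h annihilates it.
    have hψρ : ContDiff ℝ (⊤ : ℕ∞) (fun x => ψ x - I * ρ x) := hψ.sub (contDiff_const.mul hρs)
    have hψρc : HasCompactSupport (fun x => ψ x - I * ρ x) := hψc.sub (hρc.mul_left (f := fun _ => I))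
    obtain ⟨φ, hφ, hφc, hφd⟩ := exists_primitive_of_integral_eq_zero hψρ hψρc (by
      rw [integral_sub (hint hψ.continuous hψc) ((hint hρs.continuous hρc).const_mul I),
        integral_const_mul, hρ1, ← hI]; ring)
    have h1 := h0 φ hφ hφc
    rw [hφd] at h1
    have e1 : Integrable fun x => h x * ψ x :=
      hint (hh.mul hψ.continuous) (hψc.mul_left (f := h))
    have e2 : Integrable fun x => h x * ρ x :=
      hint (hh.mul hρs.continuous) (hρc.mul_left (f := h))
    have e3 : ∫ x, h x * (ψ x - I * ρ x) = ∫ x, h x * ψ x - I * (h x * ρ x) :=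
      integral_congr_ae (.of_forall fun x => by ring)
    rw [e3, integral_sub e1 (e2.const_mul I), integral_const_mul, sub_eq_zero] at h1
    simp only [smul_eq_mul]
    rw [integral_mul_const, ← hI, ← h1]
    exact integral_congr_ae (.of_forall fun x => mul_comm _ _)
  exact congrFun (hh.ae_eq_iff_eq _ continuous_const |>.1 key) x

/-- A continuous function with a weak derivative is a primitive of it. -/
theorem HasWeakDeriv.eq_add_integral {u g : ℝ → ℝ} (hu : Continuous u) (h : HasWeakDeriv u g)
    (x : ℝ) : u x = u 0 + ∫ t in (0 : ℝ)..x, g t := by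
  set G : ℝ → ℝ := fun x => ∫ t in (0 : ℝ)..x, g t with hG
  have hG0 : ∀ x, G x = G 0 + ∫ t in (0 : ℝ)..x, g t := fun x => by simp [hG]
  have hGac : LocallyAC G := .of_integral h.2.1 hG0
  have hGd := ae_deriv_eq_of_integral h.2.1 hG0
  -- Both u and G have weak derivative g, so u - G is constant.
  obtain ⟨c, hc⟩ := eq_const_of_forall_integral_mul_deriv_eq_zero (hu.sub hGac.continuous)
    fun φ hφ hφc => by
      have hd : Continuous (deriv φ) := hφ.continuous_deriv (by exact_mod_cast le_top)
      have hi : ∀ {w : ℝ → ℝ}, Continuous w → Integrable fun x => w x * deriv φ x := fun {w} hw =>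
        (hw.mul hd).integrable_of_hasCompactSupport (hφc.deriv.mul_left (f := w))
      have e : ∫ x, deriv G x * φ x = ∫ x, g x * φ x :=
        integral_congr_ae (by filter_upwards [hGd] with x hx; rw [hx])
      simp only [Pi.sub_apply, sub_mul]
      rw [integral_sub (hi hu) (hi hGac.continuous), h.2.2 φ hφ hφc,
        hGac.integral_mul_deriv hφ hφc, e, sub_self]
  have h1 := hc x
  have h2 := hc 0
  have h3 : G 0 = 0 := by simp [hG]
  simp only [Pi.sub_apply] at h1 h2
  change u x = u 0 + G x
  linarith

/-- The absolutely continuous description of `H¹(ℝ)`. -/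
theorem memH1_iff {u : ℝ → ℝ} :
    MemH1 u ↔ LocallyAC u ∧ MemLp u 2 volume ∧ MemLp (deriv u) 2 volume := by
  constructor
  · rintro ⟨hc, hu, g, hg, hg2⟩
    exact ⟨.of_integral hg.2.1 (hg.eq_add_integral hc), hu,
      hg2.ae_eq (ae_deriv_eq_of_integral hg.2.1 (hg.eq_add_integral hc)).symm⟩
  · rintro ⟨hac, hu, hd⟩
    exact ⟨hac.continuous, hu, _, hac.hasWeakDeriv, hd⟩

theorem MemH1.locallyAC {u : ℝ → ℝ} (hu : MemH1 u) : LocallyAC u := (memH1_iff.1 hu).1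

theorem MemH1.memLp {u : ℝ → ℝ} (hu : MemH1 u) : MemLp u 2 volume := (memH1_iff.1 hu).2.1

theorem MemH1.memLp_deriv {u : ℝ → ℝ} (hu : MemH1 u) : MemLp (deriv u) 2 volume :=
  (memH1_iff.1 hu).2.2

/-- `weakDeriv` is a chosen representative known only up to null sets; this passes to the pointwise
`deriv` used in every later computation. -/
theorem MemH1.energy_eq {u : ℝ → ℝ} (hu : MemH1 u) (V : ℝ → ℝ) :
    energy V u = ∫ x, (deriv u x ^ 2 + V x * u x ^ 2) := by
  refine integral_congr_ae ?_
  filter_upwards [hu.locallyAC.hasWeakDeriv.weakDeriv_ae_eq] with x hx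
  rw [hx, sq_abs, sq_abs]

/-! ### Operations on locally absolutely continuous functions -/

theorem LocallyAC.mul {u w : ℝ → ℝ} (hu : LocallyAC u) (hw : LocallyAC w) :
    LocallyAC (fun x => u x * w x) := fun a b => (hu a b).fun_mul (hw a b)

theorem LocallyAC.sub {u w : ℝ → ℝ} (hu : LocallyAC u) (hw : LocallyAC w) :
    LocallyAC (fun x => u x - w x) := fun a b => (hu a b).sub (hw a b)

theorem LocallyAC.const_mul {u : ℝ → ℝ} (c : ℝ) (hu : LocallyAC u) :
    LocallyAC (fun x => c * u x) := fun a b => (hu a b).const_mul c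

theorem LocallyAC.neg {u : ℝ → ℝ} (hu : LocallyAC u) :
    LocallyAC (fun x => -u x) := fun a b => (hu a b).neg

theorem LocallyAC.max {u w : ℝ → ℝ} (hu : LocallyAC u) (hw : LocallyAC w) :
    LocallyAC (fun x => max (u x) (w x)) := by
  intro a b
  -- Absolute continuity unfolds to convergence to 0 of sums of increments along a filter on finite
  -- interval families, so a squeeze suffices.
  have h := Filter.Tendsto.add (hu a b) (hw a b)
  rw [add_zero] at h
  refine squeeze_zero (fun E => Finset.sum_nonneg fun i _ => dist_nonneg) (fun E => ?_) h
  rw [← Finset.sum_add_distrib]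
  refine Finset.sum_le_sum fun i _ => ?_
  simp only [Real.dist_eq]
  exact (abs_max_sub_max_le_max _ _ _ _).trans (max_le_add_of_nonneg (abs_nonneg _) (abs_nonneg _))

theorem _root_.ContDiff.locallyAC {u : ℝ → ℝ} (hu : ContDiff ℝ 1 u) : LocallyAC u :=
  fun _ _ => hu.contDiffOn.absolutelyContinuousOnInterval

/-! ### Boundary values at infinity -/

theorem LocallyAC.tendsto_atTop {f : ℝ → ℝ} (hf : LocallyAC f) (hi : Integrable f)
    (hd : Integrable (deriv f)) : Tendsto f atTop (𝓝 0) := by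
  have h : Tendsto f atTop (𝓝 (f 0 + ∫ x in Ioi 0, deriv f x)) := by
    refine ((intervalIntegral_tendsto_integral_Ioi 0 hd.integrableOn tendsto_id).const_add
      (f 0)).congr fun x => ?_
    rw [hf.integral_deriv]; simp
  have h2 := hi.integrableOn (s := Ioi 0)
  -- The limit exists because f' is integrable; a nonzero limit would contradict integrability of f
  -- on a half-line of infinite measure.
  have : f 0 + ∫ x in Ioi 0, deriv f x = 0 := by
    refine IntegrableAtFilter.eq_zero_of_tendsto ⟨Ioi 0, Ioi_mem_atTop _, h2⟩ (fun s hs => ?_) h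
    obtain ⟨b, hb⟩ := mem_atTop_sets.1 hs
    rw [← top_le_iff, ← Real.volume_Ici (a := b)]
    exact measure_mono hb
  rwa [this] at h

theorem LocallyAC.integral_Ioi_deriv {f : ℝ → ℝ} (hf : LocallyAC f) (hi : Integrable f)
    (hd : Integrable (deriv f)) (a : ℝ) : ∫ x in Ioi a, deriv f x = -f a := by
  refine tendsto_nhds_unique
    (intervalIntegral_tendsto_integral_Ioi a hd.integrableOn tendsto_id) ?_
  have := (hf.tendsto_atTop hi hd).sub_const (f a)
  rw [zero_sub] at this
  exact this.congr fun x => (hf.integral_deriv a x).symm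

theorem LocallyAC.tendsto_atBot {f : ℝ → ℝ} (hf : LocallyAC f) (hi : Integrable f)
    (hd : Integrable (deriv f)) : Tendsto f atBot (𝓝 0) := by
  have h : Tendsto f atBot (𝓝 (f 0 - ∫ x in Iic 0, deriv f x)) := by
    refine ((intervalIntegral_tendsto_integral_Iic 0 hd.integrableOn tendsto_id).const_sub
      (f 0)).congr fun x => ?_
    rw [hf.integral_deriv]; simp
  have h2 := hi.integrableOn (s := Iic 0)
  have : f 0 - ∫ x in Iic 0, deriv f x = 0 := by
    refine IntegrableAtFilter.eq_zero_of_tendsto ⟨Iic 0, Iic_mem_atBot _, h2⟩ (fun s hs => ?_) h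
    obtain ⟨b, hb⟩ := mem_atBot_sets.1 hs
    rw [← top_le_iff, ← Real.volume_Iic (a := b)]
    exact measure_mono hb
  rwa [this] at h

theorem LocallyAC.integral_Iic_deriv {f : ℝ → ℝ} (hf : LocallyAC f) (hi : Integrable f)
    (hd : Integrable (deriv f)) (a : ℝ) : ∫ x in Iic a, deriv f x = f a := by
  refine tendsto_nhds_unique
    (intervalIntegral_tendsto_integral_Iic a hd.integrableOn tendsto_id) ?_
  have := (hf.tendsto_atBot hi hd).const_sub (f a)
  rw [sub_zero] at this
  exact this.congr fun x => (hf.integral_deriv x a).symm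

/-! ### Calculus in H¹ -/

theorem LocallyAC.ae_deriv_mul {u w : ℝ → ℝ} (hu : LocallyAC u) (hw : LocallyAC w) :
    deriv (fun x => u x * w x) =ᵐ[volume] fun x => deriv u x * w x + u x * deriv w x := by
  filter_upwards [hu.ae_differentiableAt, hw.ae_differentiableAt] with x h1 h2
  exact (h1.hasDerivAt.mul h2.hasDerivAt).deriv

theorem LocallyAC.ae_deriv_sub {u w : ℝ → ℝ} (hu : LocallyAC u) (hw : LocallyAC w) :
    deriv (fun x => u x - w x) =ᵐ[volume] fun x => deriv u x - deriv w x := by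
  filter_upwards [hu.ae_differentiableAt, hw.ae_differentiableAt] with x h1 h2
  exact (h1.hasDerivAt.sub h2.hasDerivAt).deriv

theorem MemH1.integrable_mul {u w : ℝ → ℝ} (hu : MemH1 u) (hw : MemH1 w) :
    Integrable fun x => u x * w x := hu.memLp.integrable_mul hw.memLp

theorem MemH1.integrable_deriv_mul_deriv {u w : ℝ → ℝ} (hu : MemH1 u) (hw : MemH1 w) :
    Integrable fun x => deriv u x * deriv w x := hu.memLp_deriv.integrable_mul hw.memLp_deriv

theorem MemH1.integrable_deriv_mul {u w : ℝ → ℝ} (hu : MemH1 u) (hw : MemH1 w) :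
    Integrable (deriv fun x => u x * w x) :=
  ((hu.memLp_deriv.integrable_mul hw.memLp).add (hu.memLp.integrable_mul hw.memLp_deriv)).congr
    (hu.locallyAC.ae_deriv_mul hw.locallyAC).symm

theorem MemH1.const_mul {u : ℝ → ℝ} (c : ℝ) (hu : MemH1 u) : MemH1 fun x => c * u x := by
  refine memH1_iff.2 ⟨hu.locallyAC.const_mul c, hu.memLp.const_mul c, ?_⟩
  have : deriv (fun x => c * u x) = fun x => c * deriv u x :=
    funext fun x => deriv_const_mul_field c
  rw [this]
  exact hu.memLp_deriv.const_mul c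

theorem MemH1.sub {u w : ℝ → ℝ} (hu : MemH1 u) (hw : MemH1 w) : MemH1 fun x => u x - w x :=
  memH1_iff.2 ⟨hu.locallyAC.sub hw.locallyAC, hu.memLp.sub hw.memLp,
    (hu.memLp_deriv.sub hw.memLp_deriv).ae_eq (hu.locallyAC.ae_deriv_sub hw.locallyAC).symm⟩

theorem MemH1.comp_add_const {u : ℝ → ℝ} (hu : MemH1 u) (d : ℝ) : MemH1 fun x => u (x + d) := by
  have hd : deriv (fun x => u (x + d)) = fun x => deriv u (x + d) :=
    funext fun x => deriv_comp_add_const u d x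
  have hmp := measurePreserving_add_right (volume : Measure ℝ) d
  have hd2 : MemLp (fun x => deriv u (x + d)) 2 volume :=
    hu.memLp_deriv.comp_measurePreserving hmp
  refine memH1_iff.2 ⟨.of_integral (hd2.locallyIntegrable (by norm_num)) fun x => ?_,
    hu.memLp.comp_measurePreserving hmp, by rwa [hd]⟩
  rw [intervalIntegral.integral_comp_add_right (fun x => deriv u x), hu.locallyAC.integral_deriv]
  ring

/-! ### Decay at infinity, attained maxima and the sup norm -/

theorem MemH1.tendsto_cocompact {u : ℝ → ℝ} (hu : MemH1 u) : Tendsto u (cocompact ℝ) (𝓝 0) := by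
  have hac := hu.locallyAC.mul hu.locallyAC
  have hi := hu.integrable_mul hu
  have hd := hu.integrable_deriv_mul hu
  have h : Tendsto (fun x => u x * u x) (cocompact ℝ) (𝓝 0) := by
    rw [cocompact_eq_atBot_atTop]
    exact (hac.tendsto_atBot hi hd).sup (hac.tendsto_atTop hi hd)
  rw [tendsto_zero_iff_abs_tendsto_zero]
  have h2 := (Real.continuous_sqrt.tendsto 0).comp h
  rw [Real.sqrt_zero] at h2
  exact h2.congr fun x => Real.sqrt_mul_self_eq_abs _

/-- A function in `H¹` attains the maximum of its absolute value. -/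
theorem MemH1.exists_forall_abs_le {u : ℝ → ℝ} (hu : MemH1 u) : ∃ a, ∀ x, |u x| ≤ |u a| := by
  by_cases h : ∀ x, u x = 0
  · exact ⟨0, fun x => by simp [h]⟩
  · push Not at h
    obtain ⟨x₀, hx₀⟩ := h
    refine hu.1.abs.exists_forall_ge' x₀ ?_
    have h1 := hu.tendsto_cocompact.abs
    rw [abs_zero] at h1
    exact (h1.eventually_lt_const (abs_pos.2 hx₀)).mono fun x hx => hx.le

/-- An a.e. bound on a continuous function holds on a closed dense set, hence everywhere, so the
essential supremum is the attained maximum. -/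
theorem supNorm_eq {u : ℝ → ℝ} (hu : Continuous u) {a : ℝ} (h : ∀ x, |u x| ≤ |u a|) :
    supNorm u = |u a| := by
  have hle : eLpNorm u ⊤ volume ≤ ENNReal.ofReal |u a| := by
    rw [eLpNorm_exponent_top]
    exact eLpNormEssSup_le_of_ae_bound (.of_forall h)
  refine le_antisymm (ENNReal.toReal_le_of_le_ofReal (abs_nonneg _) hle) ?_
  -- Finiteness matters here: `toReal` would send ⊤ to 0.
  have hfin : eLpNorm u ⊤ volume ≠ ⊤ := (hle.trans_lt ENNReal.ofReal_lt_top).ne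
  have hae : ∀ᵐ x, |u x| ≤ supNorm u := by
    rw [supNorm, eLpNorm_exponent_top]
    rw [eLpNorm_exponent_top] at hfin
    filter_upwards [ae_le_eLpNormEssSup (f := u) (μ := volume)] with x hx
    have := ENNReal.toReal_mono hfin hx
    rwa [toReal_enorm, Real.norm_eq_abs] at this
  have hcl : IsClosed {x | |u x| ≤ supNorm u} := isClosed_le hu.abs continuous_const
  have hdense : Dense {x | |u x| ≤ supNorm u} := Measure.dense_of_ae hae
  have : a ∈ closure {x | |u x| ≤ supNorm u} := hdense a
  rwa [hcl.closure_eq] at this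

theorem MemH1.abs_le_supNorm {u : ℝ → ℝ} (hu : MemH1 u) (x : ℝ) : |u x| ≤ supNorm u := by
  obtain ⟨a, ha⟩ := hu.exists_forall_abs_le
  rw [supNorm_eq hu.1 ha]
  exact ha x

theorem mem_peakSet_iff {u : ℝ → ℝ} {a : ℝ} :
    u ∈ peakSet a ↔ MemH1 u ∧ u a = 1 ∧ ∀ x, |u x| ≤ 1 := by
  constructor
  · rintro ⟨h1, h2, h3⟩
    exact ⟨h1, h2, fun x => h3 ▸ h1.abs_le_supNorm x⟩
  · rintro ⟨h1, h2, h3⟩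
    refine ⟨h1, h2, ?_⟩
    rw [supNorm_eq h1.1 (a := a) (by simpa [h2] using h3), h2, abs_one]

/-! ### The exponential kernel -/

/-- The function `exp (-k |x - a|)`, the normalized fundamental solution of `-u'' + k² u = 0`. -/
def expKernel (k a x : ℝ) : ℝ := Real.exp (-(k * |x - a|))

theorem expKernel_pos (k a x : ℝ) : 0 < expKernel k a x := Real.exp_pos _

theorem expKernel_self (k a : ℝ) : expKernel k a a = 1 := by simp [expKernel]

theorem expKernel_le_one {k : ℝ} (hk : 0 < k) (a x : ℝ) : expKernel k a x ≤ 1 :=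
  Real.exp_le_one_iff.2 (by have := mul_nonneg hk.le (abs_nonneg (x - a)); linarith)

theorem expKernel_add (k a x : ℝ) : expKernel k a (x + a) = expKernel k 0 x := by
  simp [expKernel]

theorem locallyAC_expKernel {k : ℝ} (hk : 0 < k) (a : ℝ) : LocallyAC (expKernel k a) := by
  have h1 : LocallyAC fun x => -Real.exp (k * (x - a)) :=
    ContDiff.locallyAC (by fun_prop)
  have h2 : LocallyAC fun x => -Real.exp (-(k * (x - a))) :=
    ContDiff.locallyAC (by fun_prop)
  -- The kernel is the minimum of two smooth exponentials, written with negations so that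
  -- `LocallyAC.max` applies.
  have h3 : expKernel k a =
      fun x => -max (-Real.exp (k * (x - a))) (-Real.exp (-(k * (x - a)))) := by
    funext x
    rw [max_neg_neg, neg_neg, expKernel]
    rcases le_total 0 (x - a) with h | h
    · have := mul_nonneg hk.le h
      rw [abs_of_nonneg h, min_eq_right]
      exact Real.exp_le_exp.2 (by linarith)
    · have := mul_nonpos_of_nonneg_of_nonpos hk.le h
      rw [abs_of_nonpos h, min_eq_left, mul_neg, neg_neg]
      exact Real.exp_le_exp.2 (by linarith)
  rw [h3]
  exact (h1.max h2).neg

theorem deriv_expKernel_of_lt {k a x : ℝ} (h : a < x) :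
    deriv (expKernel k a) x = -k * expKernel k a x := by
  have he : expKernel k a =ᶠ[𝓝 x] fun y => Real.exp (-(k * (y - a))) := by
    filter_upwards [lt_mem_nhds h] with y hy
    rw [expKernel, abs_of_pos (sub_pos.2 hy)]
  have hd : HasDerivAt (fun y : ℝ => -(k * (y - a))) (-k) x := by
    simpa using (((hasDerivAt_id x).sub_const a).const_mul k).fun_neg
  rw [he.deriv_eq, he.eq_of_nhds, hd.exp.deriv, mul_comm]

theorem deriv_expKernel_of_gt {k a x : ℝ} (h : x < a) :
    deriv (expKernel k a) x = k * expKernel k a x := by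
  have he : expKernel k a =ᶠ[𝓝 x] fun y => Real.exp (k * (y - a)) := by
    filter_upwards [gt_mem_nhds h] with y hy
    rw [expKernel, abs_of_neg (sub_neg.2 hy), mul_neg, neg_neg]
  have hd : HasDerivAt (fun y : ℝ => k * (y - a)) k x := by
    simpa using ((hasDerivAt_id x).sub_const a).const_mul k
  rw [he.deriv_eq, he.eq_of_nhds, hd.exp.deriv, mul_comm]

theorem ae_ne_real (a : ℝ) : ∀ᵐ x : ℝ, x ≠ a := by simp [ae_iff, measure_singleton]

theorem memH1_expKernel {k : ℝ} (hk : 0 < k) (a : ℝ) : MemH1 (expKernel k a) := by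
  have hac := locallyAC_expKernel hk a
  have h1 : MemLp (expKernel k a) 2 volume := by
    rw [memLp_two_iff_integrable_sq hac.continuous.aestronglyMeasurable,
      ← integrableOn_univ, ← Iic_union_Ioi (a := a)]
    refine IntegrableOn.union ?_ ?_
    · refine IntegrableOn.congr_fun ((integrableOn_exp_mul_Iic (a := 2 * k) (by linarith) a).const_mul
        (Real.exp (-(2 * k * a)))) (fun x hx => ?_) measurableSet_Iic
      simp only [expKernel]
      rw [← Real.exp_add, ← Real.exp_nat_mul, abs_of_nonpos (sub_nonpos.2 hx)]
      congr 1; push_cast; ring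
    · refine IntegrableOn.congr_fun ((integrableOn_exp_mul_Ioi (a := -(2 * k)) (by linarith) a).const_mul
        (Real.exp (2 * k * a))) (fun x hx => ?_) measurableSet_Ioi
      simp only [expKernel]
      rw [← Real.exp_add, ← Real.exp_nat_mul, abs_of_pos (sub_pos.2 hx)]
      congr 1; push_cast; ring
  refine memH1_iff.2 ⟨hac, h1, (h1.const_mul k).mono (measurable_deriv _).aestronglyMeasurable ?_⟩
  filter_upwards [ae_ne_real a] with x hx
  rcases lt_or_gt_of_ne hx with h | h
  · rw [deriv_expKernel_of_gt h]
  · rw [deriv_expKernel_of_lt h, neg_mul, norm_neg]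

/-- The Green function identity `⟨expKernel k a, w⟩_{k²} = 2 k w(a)`. -/
theorem integral_expKernel {k : ℝ} (hk : 0 < k) (a : ℝ) {w : ℝ → ℝ} (hw : MemH1 w) :
    ∫ x, (deriv (expKernel k a) x * deriv w x + k ^ 2 * (expKernel k a x * w x)) =
      2 * k * w a := by
  have hφ := memH1_expKernel hk a
  have hac := hφ.locallyAC.mul hw.locallyAC
  have hi := hφ.integrable_mul hw
  have hd := hφ.integrable_deriv_mul hw
  have hae := hφ.locallyAC.ae_deriv_mul hw.locallyAC
  have htot : Integrable fun x => deriv (expKernel k a) x * deriv w x +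
      k ^ 2 * (expKernel k a x * w x) := (hφ.integrable_deriv_mul_deriv hw).add (hi.const_mul (k ^ 2))
  -- On each side of a the kernel satisfies φ' = ∓kφ, which turns the integrand into ∓k(φw)'. Each
  -- half-line then contributes k w(a) through its boundary term.
  have hR : ∫ x in Ioi a, (deriv (expKernel k a) x * deriv w x + k ^ 2 * (expKernel k a x * w x)) =
      ∫ x in Ioi a, -k * deriv (fun x => expKernel k a x * w x) x := by
    refine setIntegral_congr_ae measurableSet_Ioi ?_
    filter_upwards [hae] with x hx hxa
    rw [hx, deriv_expKernel_of_lt hxa]; ring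
  have hL : ∫ x in Iic a, (deriv (expKernel k a) x * deriv w x + k ^ 2 * (expKernel k a x * w x)) =
      ∫ x in Iic a, k * deriv (fun x => expKernel k a x * w x) x := by
    refine setIntegral_congr_ae measurableSet_Iic ?_
    filter_upwards [hae, ae_ne_real a] with x hx hne hxa
    rw [hx, deriv_expKernel_of_gt (lt_of_le_of_ne hxa hne)]; ring
  rw [← intervalIntegral.integral_Iic_add_Ioi htot.integrableOn htot.integrableOn (b := a)]
  rw [hR, hL, integral_const_mul, integral_const_mul, hac.integral_Ioi_deriv hi hd,
    hac.integral_Iic_deriv hi hd, expKernel_self]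
  ring

/-! ### Energy bounds for a bounded monotone potential -/

theorem integrable_potential_mul {V f : ℝ → ℝ} {v₀ v₁ : ℝ} (hV : Monotone V)
    (h : ∀ x, V x ∈ Icc v₀ v₁) (hf : Integrable f) : Integrable fun x => V x * f x := by
  refine hf.bdd_mul (c := max |v₀| |v₁|) hV.measurable.aestronglyMeasurable (.of_forall fun x => ?_)
  rw [Real.norm_eq_abs]
  exact abs_le_max_abs_abs (h x).1 (h x).2

theorem MemH1.integrable_sq {u : ℝ → ℝ} (hu : MemH1 u) : Integrable fun x => u x ^ 2 :=
  hu.memLp.integrable_sq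

theorem MemH1.integrable_deriv_sq {u : ℝ → ℝ} (hu : MemH1 u) : Integrable fun x => deriv u x ^ 2 :=
  hu.memLp_deriv.integrable_sq

theorem MemH1.integrable_energy {V u : ℝ → ℝ} {v₀ v₁ : ℝ} (hu : MemH1 u) (hV : Monotone V)
    (h : ∀ x, V x ∈ Icc v₀ v₁) : Integrable fun x => deriv u x ^ 2 + V x * u x ^ 2 :=
  hu.integrable_deriv_sq.add (integrable_potential_mul hV h hu.integrable_sq)

theorem energy_const_mul {V u : ℝ → ℝ} (hu : MemH1 u) (c : ℝ) :
    energy V (fun x => c * u x) = c ^ 2 * energy V u := by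
  rw [(hu.const_mul c).energy_eq, hu.energy_eq, ← integral_const_mul]
  refine integral_congr_ae (.of_forall fun x => ?_)
  simp only [deriv_const_mul_field]
  ring

/-- For a constant potential `k²` the kernel has energy `2 k`. -/
theorem integral_expKernel_sq {k : ℝ} (hk : 0 < k) (a : ℝ) :
    ∫ x, (deriv (expKernel k a) x ^ 2 + k ^ 2 * expKernel k a x ^ 2) = 2 * k := by
  have := integral_expKernel hk a (memH1_expKernel hk a)
  rw [expKernel_self, mul_one] at this
  simpa only [sq] using this

/-- The sharp embedding `H¹ ⊂ L^∞` for the constant potential `k²`. -/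
theorem MemH1.mul_sq_le {u : ℝ → ℝ} (hu : MemH1 u) {k : ℝ} (hk : 0 < k) (a : ℝ) :
    2 * k * u a ^ 2 ≤ ∫ x, (deriv u x ^ 2 + k ^ 2 * u x ^ 2) := by
  have hφ := memH1_expKernel hk a
  set φ := expKernel k a with hφdef
  have i1 : Integrable fun x => deriv u x ^ 2 + k ^ 2 * u x ^ 2 :=
    hu.integrable_deriv_sq.add (hu.integrable_sq.const_mul _)
  have i2 : Integrable fun x => deriv φ x * deriv u x + k ^ 2 * (φ x * u x) :=
    (hφ.integrable_deriv_mul_deriv hu).add ((hφ.integrable_mul hu).const_mul _)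
  have i3 : Integrable fun x => deriv φ x ^ 2 + k ^ 2 * φ x ^ 2 :=
    hφ.integrable_deriv_sq.add (hφ.integrable_sq.const_mul _)
  -- This is the expansion of ‖u - u(a)φ‖² for the potential k².
  have h0 : 0 ≤ ∫ x, ((deriv u x ^ 2 + k ^ 2 * u x ^ 2) -
      (2 * u a) * (deriv φ x * deriv u x + k ^ 2 * (φ x * u x)) +
      u a ^ 2 * (deriv φ x ^ 2 + k ^ 2 * φ x ^ 2)) := by
    refine integral_nonneg fun x => ?_
    have : (0 : ℝ) ≤ (deriv u x - u a * deriv φ x) ^ 2 + k ^ 2 * (u x - u a * φ x) ^ 2 := by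
      positivity
    simp only [Pi.zero_apply]
    linarith
  have i4 : Integrable fun x => (deriv u x ^ 2 + k ^ 2 * u x ^ 2) -
      (2 * u a) * (deriv φ x * deriv u x + k ^ 2 * (φ x * u x)) := i1.sub (i2.const_mul _)
  rw [integral_add i4 (i3.const_mul _), integral_sub i1 (i2.const_mul _), integral_const_mul, integral_const_mul,
    integral_expKernel hk a hu, integral_expKernel_sq hk a] at h0
  linarith

theorem MemH1.sqrt_mul_sq_le_energy {V u : ℝ → ℝ} {v₀ v₁ : ℝ} (hu : MemH1 u) (hV : Monotone V)
    (h : ∀ x, V x ∈ Icc v₀ v₁) (hv₀ : 0 < v₀) (a : ℝ) :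
    2 * √v₀ * u a ^ 2 ≤ energy V u := by
  refine (hu.mul_sq_le (Real.sqrt_pos.2 hv₀) a).trans ?_
  rw [hu.energy_eq, Real.sq_sqrt hv₀.le]
  refine integral_mono (hu.integrable_deriv_sq.add (hu.integrable_sq.const_mul _))
    (hu.integrable_energy hV h) fun x => ?_
  have := mul_le_mul_of_nonneg_right (h x).1 (sq_nonneg (u x))
  simp only
  linarith

theorem expKernel_mem_peakSet {k : ℝ} (hk : 0 < k) (a : ℝ) : expKernel k a ∈ peakSet a :=
  mem_peakSet_iff.2 ⟨memH1_expKernel hk a, expKernel_self k a, fun x => by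
    rw [abs_of_pos (expKernel_pos k a x)]; exact expKernel_le_one hk a x⟩

/-- A real `sInf` takes a default value unless its set is nonempty and bounded below. This gives the
bound; the kernels give nonemptiness. -/
theorem sqrt_mem_lowerBounds {V : ℝ → ℝ} {v₀ v₁ : ℝ} (hV : Monotone V)
    (h : ∀ x, V x ∈ Icc v₀ v₁) (hv₀ : 0 < v₀) (a : ℝ) :
    2 * √v₀ ∈ lowerBounds (energy V '' peakSet a) := by
  rintro _ ⟨u, hu, rfl⟩
  obtain ⟨h1, h2, -⟩ := mem_peakSet_iff.1 hu
  have := h1.sqrt_mul_sq_le_energy hV h hv₀ a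
  rwa [h2, one_pow, mul_one] at this

theorem sqrt_le_peakEnergy {V : ℝ → ℝ} {v₀ v₁ : ℝ} (hV : Monotone V)
    (h : ∀ x, V x ∈ Icc v₀ v₁) (hv₀ : 0 < v₀) (a : ℝ) : 2 * √v₀ ≤ peakEnergy V a :=
  le_csInf (Set.Nonempty.image _ ⟨_, expKernel_mem_peakSet one_pos a⟩)
    (sqrt_mem_lowerBounds hV h hv₀ a)

theorem peakEnergy_le {V u : ℝ → ℝ} {v₀ v₁ : ℝ} (hV : Monotone V)
    (h : ∀ x, V x ∈ Icc v₀ v₁) (hv₀ : 0 < v₀) {a : ℝ} (hu : u ∈ peakSet a) :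
    peakEnergy V a ≤ energy V u :=
  csInf_le ⟨_, sqrt_mem_lowerBounds hV h hv₀ a⟩ ⟨u, hu, rfl⟩

/-! ### The value of m(V) and the limit of F -/

/-- The kernel `expKernel √v₀ a` is asymptotically optimal as `a → -∞`. -/
theorem tendsto_energy_expKernel {V : ℝ → ℝ} {v₀ v₁ : ℝ} (hV : Monotone V)
    (h : ∀ x, V x ∈ Icc v₀ v₁) (hv₀ : 0 < v₀) (hbot : Tendsto V atBot (𝓝 v₀)) :
    Tendsto (fun a => energy V (expKernel (√v₀) a)) atBot (𝓝 (2 * √v₀)) := by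
  have hk := Real.sqrt_pos.2 hv₀
  -- Translation moves the dependence on a from the kernel to V, leaving a fixed integrable weight
  -- for dominated convergence.
  have hE : ∀ a, energy V (expKernel (√v₀) a) =
      2 * √v₀ + ∫ x, (V (x + a) - v₀) * expKernel (√v₀) 0 x ^ 2 := by
    intro a
    have hφ := memH1_expKernel hk a
    have e : ∫ x, (V (x + a) - v₀) * expKernel (√v₀) 0 x ^ 2 =
        ∫ x, (V x * expKernel (√v₀) a x ^ 2 - v₀ * expKernel (√v₀) a x ^ 2) := by
      rw [← integral_add_right_eq_self
        (fun x => V x * expKernel (√v₀) a x ^ 2 - v₀ * expKernel (√v₀) a x ^ 2) a]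
      refine integral_congr_ae (.of_forall fun x => ?_)
      simp only [expKernel_add]; ring
    rw [e, integral_sub (integrable_potential_mul hV h hφ.integrable_sq)
      (hφ.integrable_sq.const_mul _), ← integral_expKernel_sq hk a, Real.sq_sqrt hv₀.le,
      hφ.energy_eq, integral_add hφ.integrable_deriv_sq
      (integrable_potential_mul hV h hφ.integrable_sq),
      integral_add hφ.integrable_deriv_sq (hφ.integrable_sq.const_mul _)]
    ring
  have hlim : Tendsto (fun a => ∫ x, (V (x + a) - v₀) * expKernel (√v₀) 0 x ^ 2) atBot
      (𝓝 (∫ _ : ℝ, (0 : ℝ))) := by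
    have hφ := (memH1_expKernel hk 0).integrable_sq
    refine tendsto_integral_filter_of_dominated_convergence
      (fun x => (v₁ - v₀) * expKernel (√v₀) 0 x ^ 2) (.of_forall fun a => ?_)
      (.of_forall fun a => .of_forall fun x => ?_) (hφ.const_mul _) (.of_forall fun x => ?_)
    · exact ((hV.measurable.comp (measurable_add_const a)).sub_const v₀).aestronglyMeasurable.mul
        hφ.aestronglyMeasurable
    · rw [Real.norm_eq_abs, abs_mul, abs_of_nonneg (sub_nonneg.2 (h _).1),
        abs_of_nonneg (sq_nonneg _)]
      exact mul_le_mul_of_nonneg_right (by linarith [(h (x + a)).2]) (sq_nonneg _)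
    · have h1 : Tendsto (fun a => V (x + a)) atBot (𝓝 v₀) :=
        hbot.comp (tendsto_atBot_add_const_left _ x tendsto_id)
      simpa using (h1.sub_const v₀).mul_const (expKernel (√v₀) 0 x ^ 2)
  simp_rw [hE]
  simpa using hlim.const_add (2 * √v₀)

theorem tendsto_peakEnergy {V : ℝ → ℝ} {v₀ v₁ : ℝ} (hV : Monotone V)
    (h : ∀ x, V x ∈ Icc v₀ v₁) (hv₀ : 0 < v₀) (hbot : Tendsto V atBot (𝓝 v₀)) :
    Tendsto (peakEnergy V) atBot (𝓝 (2 * √v₀)) :=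
  tendsto_of_tendsto_of_tendsto_of_le_of_le tendsto_const_nhds
    (tendsto_energy_expKernel hV h hv₀ hbot) (sqrt_le_peakEnergy hV h hv₀)
    fun a => peakEnergy_le hV h hv₀ (expKernel_mem_peakSet (Real.sqrt_pos.2 hv₀) a)

theorem supNorm_pos {u : ℝ → ℝ} (hu : MemH1 u) (h0 : u ≠ 0) : 0 < supNorm u := by
  obtain ⟨x, hx⟩ := Function.ne_iff.1 h0
  exact (abs_pos.2 hx).trans_le (hu.abs_le_supNorm x)

theorem sqrt_le_rayleigh {V u : ℝ → ℝ} {v₀ v₁ : ℝ} (hV : Monotone V)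
    (h : ∀ x, V x ∈ Icc v₀ v₁) (hv₀ : 0 < v₀) (hu : MemH1 u) (h0 : u ≠ 0) :
    2 * √v₀ ≤ rayleigh V u := by
  have hpos := supNorm_pos hu h0
  rw [rayleigh, le_div_iff₀ (by positivity)]
  obtain ⟨a, ha⟩ := hu.exists_forall_abs_le
  rw [supNorm_eq hu.1 ha, sq_abs]
  exact hu.sqrt_mul_sq_le_energy hV h hv₀ a

theorem infRayleigh_eq {V : ℝ → ℝ} {v₀ v₁ : ℝ} (hV : Monotone V)
    (h : ∀ x, V x ∈ Icc v₀ v₁) (hv₀ : 0 < v₀) (hbot : Tendsto V atBot (𝓝 v₀)) :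
    infRayleigh V = 2 * √v₀ := by
  have hk := Real.sqrt_pos.2 hv₀
  have hlb : 2 * √v₀ ∈ lowerBounds (rayleigh V '' {u | MemH1 u ∧ u ≠ 0}) := by
    rintro _ ⟨u, ⟨hu, h0⟩, rfl⟩
    exact sqrt_le_rayleigh hV h hv₀ hu h0
  have hmem : ∀ a, rayleigh V (expKernel (√v₀) a) ∈ rayleigh V '' {u | MemH1 u ∧ u ≠ 0} :=
    fun a => ⟨_, ⟨memH1_expKernel hk a, fun h => by
      have := expKernel_self (√v₀) a
      simp [h] at this⟩, rfl⟩
  refine le_antisymm ?_ (le_csInf ⟨_, hmem 0⟩ hlb)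
  -- The quotient of each kernel is its energy, since its sup norm is 1, and bounds m(V) from above;
  -- these energies tend to 2√v₀.
  refine ge_of_tendsto' (tendsto_energy_expKernel hV h hv₀ hbot) fun a => ?_
  have := csInf_le ⟨_, hlb⟩ (hmem a)
  rwa [rayleigh, (expKernel_mem_peakSet hk a).2.2, one_pow, div_one] at this

/-! ### Truncation from below by a subsolution -/

/-- At a point where both functions are differentiable and touch, the derivatives of ordered
functions agree. -/
theorem deriv_eq_of_le_of_eq {f g : ℝ → ℝ} {x : ℝ} (hf : DifferentiableAt ℝ f x)
    (hg : DifferentiableAt ℝ g x) (hle : ∀ y, f y ≤ g y) (heq : f x = g x) :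
    deriv f x = deriv g x := by
  have hmin : IsLocalMin (fun y => g y - f y) x :=
    .of_forall fun y => by simp only [heq, sub_self]; exact sub_nonneg.2 (hle y)
  have := hmin.deriv_eq_zero
  rw [deriv_fun_sub hg hf] at this
  linarith

/-- At almost every point u, w and the maximum are all differentiable, and the maximum touches the
larger of the two from above, so it has the same derivative there. -/
theorem ae_deriv_max {u w : ℝ → ℝ} (hu : LocallyAC u) (hw : LocallyAC w) :
    ∀ᵐ x, (w x ≤ u x ∧ deriv (fun x => max (u x) (w x)) x = deriv u x) ∨
      (u x ≤ w x ∧ deriv (fun x => max (u x) (w x)) x = deriv w x) := by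
  filter_upwards [hu.ae_differentiableAt, hw.ae_differentiableAt,
    (hu.max hw).ae_differentiableAt] with x h1 h2 h3
  rcases le_total (w x) (u x) with h | h
  · exact .inl ⟨h, (deriv_eq_of_le_of_eq h1 h3 (fun y => le_max_left _ _) (max_eq_left h).symm).symm⟩
  · exact .inr ⟨h, (deriv_eq_of_le_of_eq h2 h3 (fun y => le_max_right _ _)
      (max_eq_right h).symm).symm⟩

theorem MemH1.max {u w : ℝ → ℝ} (hu : MemH1 u) (hw : MemH1 w) :
    MemH1 fun x => max (u x) (w x) := by
  refine memH1_iff.2 ⟨hu.locallyAC.max hw.locallyAC, hu.memLp.sup hw.memLp,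
    (hu.memLp_deriv.norm.add hw.memLp_deriv.norm).mono
      (measurable_deriv _).aestronglyMeasurable ?_⟩
  filter_upwards [ae_deriv_max hu.locallyAC hw.locallyAC] with x hx
  simp only [Pi.add_apply, Real.norm_eq_abs]
  rw [abs_of_nonneg (a := |deriv u x| + |deriv w x|) (by positivity)]
  rcases hx with ⟨-, h⟩ | ⟨-, h⟩ <;> rw [h] <;>
    linarith [abs_nonneg (deriv u x), abs_nonneg (deriv w x)]

/-- Taking the maximum with the subsolution `expKernel √v₁ a` does not increase the energy. -/
theorem energy_max_expKernel_le {V u : ℝ → ℝ} {v₀ v₁ a : ℝ} (hV : Monotone V)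
    (h : ∀ x, V x ∈ Icc v₀ v₁) (hv₀ : 0 < v₀) (hu : MemH1 u) (hua : u a = 1) :
    energy V (fun x => max (u x) (expKernel (√v₁) a x)) ≤ energy V u := by
  have hv₁ : 0 < v₁ := hv₀.trans_le ((h 0).1.trans (h 0).2)
  have hk := Real.sqrt_pos.2 hv₁
  have hφ := memH1_expKernel hk a
  set φ := expKernel (√v₁) a with hφdef
  have hm := hu.max hφ
  have hw := hm.sub hu
  set m := fun x => max (u x) (φ x) with hmdef
  set w := fun x => m x - u x with hwdef
  -- Here w = (φ - u)⁺. It vanishes at the pole of the kernel because u(a) = φ(a) = 1, so the Green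
  -- identity makes the pairing of φ with w zero.
  have hwa : w a = 0 := by simp [hwdef, hmdef, hφdef, hua, expKernel_self]
  have hB := integral_expKernel hk a hw
  rw [hwa, mul_zero, Real.sq_sqrt hv₁.le] at hB
  have i1 : Integrable fun x => deriv φ x * deriv w x + v₁ * (φ x * w x) :=
    (hφ.integrable_deriv_mul_deriv hw).add ((hφ.integrable_mul hw).const_mul _)
  have key : ∫ x, (deriv m x ^ 2 + V x * m x ^ 2) ≤ ∫ x, ((deriv u x ^ 2 + V x * u x ^ 2) +
      2 * (deriv φ x * deriv w x + v₁ * (φ x * w x))) := by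
    refine integral_mono_ae (hm.integrable_energy hV h)
      ((hu.integrable_energy hV h).add (i1.const_mul 2)) ?_
    filter_upwards [ae_deriv_max hu.locallyAC hφ.locallyAC,
      hm.locallyAC.ae_deriv_sub hu.locallyAC] with x hx hdw
    have hdw' : deriv w x = deriv m x - deriv u x := hdw
    rcases hx with ⟨hle, hd⟩ | ⟨hle, hd⟩
    · have e1 : m x = u x := max_eq_left hle
      have e2 : w x = 0 := by simp [hwdef, e1]
      have e3 : deriv m x = deriv u x := hd
      rw [hdw', e1, e2, e3]
      simp
    · have e1 : m x = φ x := max_eq_right hle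
      have e2 : w x = φ x - u x := by simp [hwdef, e1]
      have e3 : deriv m x = deriv φ x := hd
      rw [hdw', e1, e2, e3]
      -- Where u ≤ φ, replacing v₁ by V in the term 2v₁φ(φ - u) only lowers the right side. The
      -- difference of the two sides is then at least (φ' - u')² + V(φ - u)².
      have hp : 0 ≤ φ x * (φ x - u x) :=
        mul_nonneg (expKernel_pos _ _ _).le (sub_nonneg.2 hle)
      have h1 := mul_le_mul_of_nonneg_right (h x).2 hp
      have h2 := mul_nonneg (hv₀.le.trans (h x).1) (sq_nonneg (φ x - u x))
      nlinarith [sq_nonneg (deriv φ x - deriv u x)]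
  rw [integral_add (hu.integrable_energy hV h) (i1.const_mul 2), integral_const_mul, hB,
    mul_zero, add_zero] at key
  rwa [hm.energy_eq, hu.energy_eq]

/-! ### Translation, strict monotonicity and absence of minimizers -/

theorem energy_comp_add_const {V u : ℝ → ℝ} (hu : MemH1 u) (d : ℝ) :
    energy V (fun x => u (x + d)) = ∫ x, (deriv u x ^ 2 + V (x - d) * u x ^ 2) := by
  rw [(hu.comp_add_const d).energy_eq,
    ← integral_add_right_eq_self (fun x => deriv u x ^ 2 + V (x - d) * u x ^ 2) d]
  refine integral_congr_ae (.of_forall fun x => ?_)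
  simp only [deriv_comp_add_const, add_sub_cancel_right]

/-- A nonconstant monotone function gains a positive amount of weighted mass under translation. -/
theorem integral_sub_comp_sub_pos {V f : ℝ → ℝ} {v₀ v₁ d : ℝ} (hV : Monotone V)
    (h : ∀ x, V x ∈ Icc v₀ v₁) (hbot : Tendsto V atBot (𝓝 v₀)) (htop : Tendsto V atTop (𝓝 v₁))
    (hlt : v₀ < v₁) (hd : 0 < d) (hf : Integrable f) (hpos : ∀ x, 0 < f x) :
    0 < ∫ x, (V x - V (x - d)) * f x := by
  have hVd : Monotone fun x => V (x - d) := fun x y hxy => hV (by linarith)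
  have hnn : ∀ x, 0 ≤ V x - V (x - d) := fun x => sub_nonneg.2 (hV (by linarith))
  have hint : Integrable fun x => (V x - V (x - d)) * f x := by
    simp only [sub_mul]
    exact (integrable_potential_mul hV h hf).sub
      (integrable_potential_mul hVd (fun x => h (x - d)) hf)
  -- The half step d/2 leaves room: for every x in (s, s + d/2) the interval [x - d, x] contains [s
  -- - d/2, s], so the increment of V is positive on a set of positive measure. Without such an s, V
  -- would have period d/2 and both limits would equal V(0).
  obtain ⟨s, hs⟩ : ∃ s, V (s - d / 2) < V s := by
    by_contra hcon
    push Not at hcon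
    have hstep : ∀ s, V (s - d / 2) = V s := fun s => le_antisymm (hV (by linarith)) (hcon s)
    have hn : ∀ n : ℕ, V (n * (d / 2)) = V 0 := by
      intro n
      induction n with
      | zero => simp
      | succ n ih => rw [← ih, ← hstep]; congr 1; push_cast; ring
    have hn' : ∀ n : ℕ, V (-(n * (d / 2))) = V 0 := by
      intro n
      induction n with
      | zero => simp
      | succ n ih => rw [← ih, ← hstep (-(n * (d / 2)))]; congr 1; push_cast; ring
    have hT : Tendsto (fun n : ℕ => (n : ℝ) * (d / 2)) atTop atTop :=
      tendsto_natCast_atTop_atTop.atTop_mul_const (by linarith)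
    have h1 := htop.comp hT
    have h2 := hbot.comp (tendsto_neg_atTop_atBot.comp hT)
    have e1 : V 0 = v₁ := tendsto_nhds_unique
      (tendsto_const_nhds.congr fun n => (hn n).symm) h1
    have e2 : V 0 = v₀ := tendsto_nhds_unique
      (tendsto_const_nhds.congr fun n => (hn' n).symm) h2
    linarith
  rw [integral_pos_iff_support_of_nonneg (fun x => mul_nonneg (hnn x) (hpos x).le) hint]
  refine lt_of_lt_of_le ?_ (measure_mono (s := Ioo s (s + d / 2)) fun x hx => ?_)
  · rw [Real.volume_Ioo]; simpa using hd
  · have h1 := hV hx.1.le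
    have h2 := hV (show x - d ≤ s - d / 2 by linarith [hx.2])
    exact (mul_pos (by linarith) (hpos x)).ne'

theorem strictMono_peakEnergy {V : ℝ → ℝ} {v₀ v₁ : ℝ} (hV : Monotone V)
    (h : ∀ x, V x ∈ Icc v₀ v₁) (hv₀ : 0 < v₀) (hbot : Tendsto V atBot (𝓝 v₀))
    (htop : Tendsto V atTop (𝓝 v₁)) (hlt : v₀ < v₁) : StrictMono (peakEnergy V) := by
  intro a b hab
  have hk := Real.sqrt_pos.2 (hv₀.trans hlt)
  set d := b - a with hd
  have hφ := memH1_expKernel hk b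
  set φ := expKernel (√v₁) b with hφdef
  have hφpos : ∀ x, 0 < φ x := expKernel_pos _ _
  have hgain := integral_sub_comp_sub_pos hV h hbot htop hlt (sub_pos.2 hab) hφ.integrable_sq
    fun x => pow_pos (hφpos x) 2
  -- It suffices to bound every admissible energy at b below by F(a) plus a gain independent of u;
  -- no minimizer of F(b) is needed.
  refine lt_of_lt_of_le (lt_add_of_pos_right _ hgain)
    (le_csInf (Set.Nonempty.image _ ⟨_, expKernel_mem_peakSet hk b⟩) ?_)
  rintro _ ⟨u, hu, rfl⟩
  obtain ⟨hu1, hub, hule⟩ := mem_peakSet_iff.1 hu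
  have hm := hu1.max hφ
  refine le_trans ?_ (energy_max_expKernel_le hV h hv₀ hu1 hub)
  set m := fun x => max (u x) (φ x) with hmdef
  have hmem : (fun x => m (x + d)) ∈ peakSet a := by
    refine mem_peakSet_iff.2 ⟨hm.comp_add_const d, ?_, fun x => abs_le.2 ⟨?_, ?_⟩⟩
    · simp [hmdef, hd, hub, hφdef, expKernel_self]
    · exact (abs_le.1 (hule _)).1.trans (le_max_left _ _)
    · exact max_le (abs_le.1 (hule _)).2 (expKernel_le_one hk _ _)
  have hVd : Monotone fun x => V (x - d) := fun x y hxy => hV (by linarith)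
  have hhd : ∀ x, V (x - d) ∈ Icc v₀ v₁ := fun x => h (x - d)
  have h1 := peakEnergy_le hV h hv₀ hmem
  rw [energy_comp_add_const hm] at h1
  have iφ : Integrable fun x => (V x - V (x - d)) * φ x ^ 2 := by
    simp only [sub_mul]
    exact (integrable_potential_mul hV h hφ.integrable_sq).sub
      (integrable_potential_mul hVd hhd hφ.integrable_sq)
  refine (add_le_add_left h1 _).trans ?_
  rw [hm.energy_eq, ← integral_add (hm.integrable_energy hVd hhd) iφ]
  refine integral_mono ((hm.integrable_energy hVd hhd).add iφ) (hm.integrable_energy hV h)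
    fun x => ?_
  -- Since m ≥ φ > 0, the gain for m dominates the fixed gain for φ.
  have h2 : φ x ^ 2 ≤ m x ^ 2 := pow_le_pow_left₀ (hφpos x).le (le_max_right _ _) 2
  have h3 := mul_le_mul_of_nonneg_left h2
    (sub_nonneg.2 (hV (show x - d ≤ x by linarith)))
  simp only
  linarith

/-- Rescaling a minimizer to have value 1 at its peak a gives an element of `peakSet a` with energy
2√v₀. This contradicts 2√v₀ ≤ F(a - 1) < F(a). -/
theorem minimizers_eq_empty {V : ℝ → ℝ} {v₀ v₁ : ℝ} (hV : Monotone V)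
    (h : ∀ x, V x ∈ Icc v₀ v₁) (hv₀ : 0 < v₀) (hbot : Tendsto V atBot (𝓝 v₀))
    (htop : Tendsto V atTop (𝓝 v₁)) (hlt : v₀ < v₁) : minimizers V = ∅ := by
  refine eq_empty_of_forall_notMem fun u => ?_
  rintro ⟨hu, hmin, h0⟩
  obtain ⟨a, ha⟩ := hu.exists_forall_abs_le
  have hS := supNorm_eq hu.1 ha
  have hpos := supNorm_pos hu h0
  rw [hS] at hpos
  have hua : u a ≠ 0 := abs_pos.1 hpos
  -- Dividing by u(a) rather than |u(a)| also corrects the sign.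
  have hmem : (fun x => (u a)⁻¹ * u x) ∈ peakSet a := by
    refine mem_peakSet_iff.2 ⟨hu.const_mul _, inv_mul_cancel₀ hua, fun x => ?_⟩
    rw [abs_mul, abs_inv, inv_mul_le_one₀ hpos]
    exact ha x
  have h1 := peakEnergy_le hV h hv₀ hmem
  have h2 := strictMono_peakEnergy hV h hv₀ hbot htop hlt (sub_one_lt a)
  have h3 := sqrt_le_peakEnergy hV h hv₀ (a - 1)
  rw [infRayleigh_eq hV h hv₀ hbot, rayleigh, hS, sq_abs, div_eq_inv_mul, ← inv_pow,
    ← energy_const_mul hu] at hmin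
  linarith

end SobolevConst

end

theorem mainTheorem8 (V : ℝ → ℝ) (v₀ v₁ : ℝ) (hV : Monotone V) (hv₀ : 0 < v₀)
    (hbot : Filter.Tendsto V Filter.atBot (nhds v₀))
    (htop : Filter.Tendsto V Filter.atTop (nhds v₁)) :
    SobolevConst.infRayleigh V = 2 * Real.sqrt v₀ ∧
    Filter.Tendsto (SobolevConst.peakEnergy V) Filter.atBot (nhds (2 * Real.sqrt v₀)) ∧
    (v₀ < v₁ →
      StrictMono (SobolevConst.peakEnergy V) ∧ SobolevConst.minimizers V = ∅) := by
  have h : ∀ x, V x ∈ Set.Icc v₀ v₁ := fun x => ⟨hV.le_of_tendsto hbot x, hV.ge_of_tendsto htop x⟩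
  exact ⟨SobolevConst.infRayleigh_eq hV h hv₀ hbot,
    SobolevConst.tendsto_peakEnergy hV h hv₀ hbot, fun hlt =>
      ⟨SobolevConst.strictMono_peakEnergy hV h hv₀ hbot htop hlt,
        SobolevConst.minimizers_eq_empty hV h hv₀ hbot htop hlt⟩⟩
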